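/- For a finite group $G$, a stem extension of $G$ is a surjective group homomorphism $\pi\colon E\to G$ with $\ker\pi\subseteq Z(E)\cap E'$, where $E'$ is the derived subgroup, and a Schur cover of $G$ is a stem extension with $|E|$ maximal. Given a Schur cover $\pi\colon\tilde G\to G$, the deep commuting graph $\Delta_D(G)$ is the simple graph with vertex set $G$ in which two distinct elements are adjacent if and only if their preimages under $\pi$ commute in $\tilde G$. The enhanced power graph $\mathcal P_e(G)$ is the simple graph with vertex set $G$ in which two distinct elements $x,y$ are adjacent if and only if $\langle x,y\rangle$ is cyclic. Theorem. Every finite abelian group has a Schur cover, and the following hold, whichever Schur cover is used to form $\Delta_D$. (i) Let $p$ be a prime and let $G$ be a finite non-cyclic abelian $p$-group. Then $\Delta_D(G)=\mathcal P_e(G)$ if and only if $G$ is elementary abelian (that is, $x^p=1$ for all $x\in G$). (ii) Let $A$ be a finite abelian group. Then $\Delta_D(A)=\mathcal P_e(A)$ if and only if, for every prime $p$, the Sylow $p$-subgroup of $A$ is cyclic or elementary abelian. -/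

import Mathlib

universe u

/-- `π : E →* G` is a stem extension of `G`: it is onto, and its kernel is contained in both the
centre and the derived subgroup of `E`. -/
structure IsStemExtension {G E : Type u} [Group G] [Group E] (π : E →* G) : Prop where
  surjective : Function.Surjective π
  ker_le_center : π.ker ≤ Subgroup.center E
  ker_le_commutator : π.ker ≤ commutator E

/-- `π : E →* G` is a Schur cover of the finite group `G`: a stem extension of maximal order.
(All stem extensions of a finite group are finite.) -/
structure IsSchurCover {G E : Type u} [Group G] [Group E] (π : E →* G) : Prop where
  stem : IsStemExtension π
  finite : Finite E
  maximal : ∀ (F : Type u) [Group F] [Finite F] (ρ : F →* G),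
    IsStemExtension ρ → Nat.card F ≤ Nat.card E

/-- The deep commuting graph of `G`, computed in the Schur cover `π : E →* G`: distinct elements
of `G` are adjacent when their preimages in `E` commute. -/
def deepCommutingGraph {G E : Type u} [Group G] [Group E] (π : E →* G) : SimpleGraph G where
  Adj x y := x ≠ y ∧ ∀ a b : E, π a = x → π b = y → Commute a b
  symm := ⟨fun _ _ h => ⟨h.1.symm, fun a b ha hb => (h.2 b a hb ha).symm⟩⟩
  loopless := ⟨fun _ h => h.1 rfl⟩

/-- The enhanced power graph of `G`: distinct `x`, `y` are adjacent when `⟨x, y⟩` is cyclic. -/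
def enhancedPowerGraph (G : Type u) [Group G] : SimpleGraph G where
  Adj x y := x ≠ y ∧ IsCyclic (Subgroup.closure ({x, y} : Set G))
  symm := ⟨fun x y h => ⟨h.1.symm, by rw [Set.pair_comm]; exact h.2⟩⟩
  loopless := ⟨fun _ h => h.1 rfl⟩

/-- `G` is an elementary abelian `p`-group. -/
def IsElementaryAbelian (p : ℕ) (G : Type u) [Group G] : Prop :=
  (∀ x y : G, x * y = y * x) ∧ ∀ x : G, x ^ p = 1

/-! In a stem extension of an abelian group $A$, commutators are central and depend only on images
in $A$. They therefore form an alternating bilinear map that factors through $\Lambda^2 A$, whose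
image contains the kernel (`exists_extSquare_hom`). Hence $|E| \le |A|\,|\Lambda^2 A|$, and a
bilinear cocycle $\beta$ with $\beta - \beta^T = \wedge$ attains the bound. In every Schur cover
$\Lambda^2 A$ thus embeds, so adjacency means $x \wedge y = 0$ (`IsSchurCover.commute_iff`).

A cyclic $\langle x, y\rangle$ forces $x \wedge y = 0$; only the converse is at issue. It fails if
some Sylow subgroup is neither cyclic nor elementary abelian: take $w$ of order $p^2$ and $v$ of
order $p$ outside $\langle w^p\rangle$; then $w^p \wedge v = w \wedge v^p = 0$. Otherwise it is
checked one prime at a time, with linear forms separating independent vectors in the elementary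
abelian case. Part (i) is the case of a single prime. -/

open scoped TensorProduct DirectSum commutatorElement IsMulCommutative

/-! ### Exterior squares and alternating maps -/

section ExteriorSquare

variable {B C : Type*} [AddCommGroup B] [AddCommGroup C]

/-- A biadditive map as a `ℤ`-bilinear map. -/
def bilinOfAdd (f : B → B → C) (hl : ∀ x x' y, f (x + x') y = f x y + f x' y)
    (hr : ∀ x y y', f x (y + y') = f x y + f x y') : B →ₗ[ℤ] B →ₗ[ℤ] C :=
  (AddMonoidHom.mk' (fun x => (AddMonoidHom.mk' (f x) (hr x)).toIntLinearMap)
    (fun x x' => LinearMap.ext fun y => hl x x' y)).toIntLinearMap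

@[simp]
theorem bilinOfAdd_apply (f : B → B → C) (hl : ∀ x x' y, f (x + x') y = f x y + f x' y)
    (hr : ∀ x y y', f x (y + y') = f x y + f x y') (x y : B) :
    bilinOfAdd f hl hr x y = f x y := rfl

/-- The exterior square of an abelian group. -/
abbrev ExtSquare (B : Type*) [AddCommGroup B] : Type _ :=
  (B ⊗[ℤ] B) ⧸ Submodule.span ℤ (Set.range fun x : B => x ⊗ₜ[ℤ] x)

/-- The universal alternating map `(x, y) ↦ x ∧ y`. -/
def wedge : B →ₗ[ℤ] B →ₗ[ℤ] ExtSquare B :=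
  (TensorProduct.mk ℤ B B).compr₂ (Submodule.mkQ _)

theorem wedge_self (x : B) : wedge x x = 0 :=
  (Submodule.Quotient.mk_eq_zero _).2 (Submodule.subset_span ⟨x, rfl⟩)

/-- The universal property of the exterior square. -/
theorem exists_extSquare_lift (ω : B →ₗ[ℤ] B →ₗ[ℤ] C) (hω : ∀ x, ω x x = 0) :
    ∃ f : ExtSquare B →ₗ[ℤ] C, ∀ x y, f (wedge x y) = ω x y := by
  refine ⟨Submodule.liftQ _ (TensorProduct.lift ω) ?_, fun x y => ?_⟩
  · rw [Submodule.span_le]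
    rintro _ ⟨x, rfl⟩
    exact (TensorProduct.lift.tmul x x).trans (hω x)
  · exact TensorProduct.lift.tmul x y

/-- The quotient is finitely generated and killed by $|B|$. -/
instance finite_extSquare [Finite B] : Finite (ExtSquare B) := by
  have : Module.Finite ℤ B := Module.Finite.of_finite
  have : Module.Finite ℤ (B ⊗[ℤ] B) := Module.Finite.tensorProduct ℤ B B
  have : Module.Finite ℤ (ExtSquare B) := Module.Finite.quotient ℤ _
  refine Module.finite_of_fg_torsion _ fun {w} => ?_
  have hn : (Nat.card B : ℤ) ≠ 0 := by exact_mod_cast Nat.card_pos.ne'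
  refine ⟨⟨(Nat.card B : ℤ), mem_nonZeroDivisors_of_ne_zero hn⟩, ?_⟩
  obtain ⟨t, rfl⟩ := Submodule.Quotient.mk_surjective _ w
  rw [Submonoid.smul_def, ← Submodule.Quotient.mk_smul]
  suffices (Nat.card B : ℤ) • t = 0 by rw [this]; rfl
  induction t with
  | zero => simp
  | tmul x y => rw [TensorProduct.smul_tmul', natCast_zsmul, card_nsmul_eq_zero',
      TensorProduct.zero_tmul]
  | add x y hx hy => rw [smul_add, hx, hy, add_zero]

theorem alternating_swap {ω : B →ₗ[ℤ] B →ₗ[ℤ] C} (hω : ∀ x, ω x x = 0) (x y : B) :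
    ω x y = -ω y x := by
  have h := hω (x + y)
  simp only [map_add, LinearMap.add_apply, hω, zero_add, add_zero] at h
  exact eq_neg_of_add_eq_zero_right h

/-- Multiples of a common element have trivial alternating product. -/
theorem alternating_zsmul {ω : B →ₗ[ℤ] B →ₗ[ℤ] C} (hω : ∀ x, ω x x = 0) (g : B) (m n : ℤ) :
    ω (m • g) (n • g) = 0 := by
  simp [hω]

/-- On a finite abelian group every alternating bilinear map has the form `β - βᵀ` with `β`
bilinear. -/
theorem exists_bilin_sub_flip [Finite B] (ω : B →ₗ[ℤ] B →ₗ[ℤ] C) (hω : ∀ x, ω x x = 0) :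
    ∃ β : B →ₗ[ℤ] B →ₗ[ℤ] C, ∀ x y, β x y - β y x = ω x y := by
  classical
  obtain ⟨ι, _, n, hn, ⟨e⟩⟩ := AddCommGroup.equiv_directSum_zmod_of_finite' B
  let _ : LinearOrder ι := LinearOrder.lift' (Fintype.equivFin ι) (Fintype.equivFin ι).injective
  let P (i : ι) : B →ₗ[ℤ] B :=
    (AddMonoidHom.mk' (fun x => e.symm (DirectSum.of (fun i => ZMod (n i)) i (e x i)))
      (fun x y => by simp)).toIntLinearMap
  have hP (i : ι) (x : B) : P i x = e.symm (DirectSum.of (fun i => ZMod (n i)) i (e x i)) := rfl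
  have hsum (x : B) : ∑ i, P i x = x := by
    simp only [hP]
    rw [← map_sum, DirectSum.sum_univ_of, AddEquiv.symm_apply_apply]
  have hdiag (i : ι) (x y : B) : ω (P i x) (P i y) = 0 := by
    have key (z : B) : P i z =
        ((e z i).cast : ℤ) • e.symm (DirectSum.of (fun i => ZMod (n i)) i 1) := by
      rw [hP, ← map_zsmul, ← map_zsmul, zsmul_one, ZMod.intCast_zmod_cast]
    rw [key x, key y]
    exact alternating_zsmul hω _ _ _
  -- Keep the strictly upper triangular part of `ω` for the cyclic decomposition, under an arbitrary
  -- order of the summands; diagonal blocks vanish because each summand is cyclic.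
  refine ⟨∑ i, ∑ j, if i < j then ω.compl₁₂ (P i) (P j) else 0, fun x y => ?_⟩
  have hβ (x y : B) : (∑ i, ∑ j, if i < j then ω.compl₁₂ (P i) (P j) else 0 :
      B →ₗ[ℤ] B →ₗ[ℤ] C) x y = ∑ i, ∑ j, if i < j then ω (P i x) (P j y) else 0 := by
    simp only [LinearMap.sum_apply]
    refine Finset.sum_congr rfl fun i _ => Finset.sum_congr rfl fun j _ => ?_
    split_ifs <;> simp
  have hω' : ω x y = ∑ i, ∑ j, ω (P i x) (P j y) := by
    conv_lhs => rw [← hsum x, ← hsum y]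
    simp only [map_sum, LinearMap.sum_apply]
    exact Finset.sum_comm
  rw [hβ, hβ, hω', Finset.sum_comm (f := fun i j => if i < j then ω (P i y) (P j x) else 0)]
  simp only [← Finset.sum_sub_distrib]
  refine Finset.sum_congr rfl fun i _ => Finset.sum_congr rfl fun j _ => ?_
  rcases lt_trichotomy i j with h | rfl | h
  · simp [h, h.not_gt]
  · simp [hdiag]
  · simp only [h, h.not_gt, if_true, if_false, zero_sub]
    exact (alternating_swap hω _ _).symm

end ExteriorSquare

/-! ### Central extensions from bilinear cocycles -/

section BilinearExtension

/-- The central extension of `Multiplicative B` by `C` with the bilinear cocycle `β`. -/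
@[ext]
structure BilinExtension {B C : Type*} [AddCommGroup B] [AddCommGroup C]
    (β : B →ₗ[ℤ] B →ₗ[ℤ] C) where
  /-- The coordinate in the kernel. -/
  fiber : C
  /-- The coordinate in the quotient. -/
  base : B

namespace BilinExtension

variable {B C : Type*} [AddCommGroup B] [AddCommGroup C] {β : B →ₗ[ℤ] B →ₗ[ℤ] C}

instance : Mul (BilinExtension β) :=
  ⟨fun g h => ⟨g.fiber + h.fiber + β g.base h.base, g.base + h.base⟩⟩

instance : One (BilinExtension β) := ⟨⟨0, 0⟩⟩

instance : Inv (BilinExtension β) := ⟨fun g => ⟨-g.fiber + β g.base g.base, -g.base⟩⟩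

@[simp] theorem mul_fiber (g h : BilinExtension β) :
    (g * h).fiber = g.fiber + h.fiber + β g.base h.base := rfl
@[simp] theorem mul_base (g h : BilinExtension β) : (g * h).base = g.base + h.base := rfl
@[simp] theorem one_fiber : (1 : BilinExtension β).fiber = 0 := rfl
@[simp] theorem one_base : (1 : BilinExtension β).base = 0 := rfl
@[simp] theorem inv_fiber (g : BilinExtension β) :
    g⁻¹.fiber = -g.fiber + β g.base g.base := rfl
@[simp] theorem inv_base (g : BilinExtension β) : g⁻¹.base = -g.base := rfl

instance : Group (BilinExtension β) :=
  Group.ofLeftAxioms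
    (fun a b c => by ext <;> simp <;> abel)
    (fun a => by ext <;> simp)
    (fun a => by ext <;> simp)

/-- The underlying set of the extension is a product. -/
def equivProd (β : B →ₗ[ℤ] B →ₗ[ℤ] C) : BilinExtension β ≃ C × B where
  toFun g := (g.fiber, g.base)
  invFun x := ⟨x.1, x.2⟩
  left_inv _ := rfl
  right_inv _ := rfl

theorem commutatorElement_eq (g h : BilinExtension β) :
    ⁅g, h⁆ = ⟨β g.base h.base - β h.base g.base, 0⟩ := by
  rw [commutatorElement_def]
  ext <;> simp
  abel

/-- The inclusion of the kernel. -/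
def incl (β : B →ₗ[ℤ] B →ₗ[ℤ] C) : Multiplicative C →* BilinExtension β where
  toFun c := ⟨c.toAdd, 0⟩
  map_one' := rfl
  map_mul' c d := by ext <;> simp

/-- The projection to the quotient. -/
def proj (A : Type*) [CommGroup A] (β : Additive A →ₗ[ℤ] Additive A →ₗ[ℤ] C) :
    BilinExtension β →* A where
  toFun g := g.base.toMul
  map_one' := rfl
  map_mul' _ _ := rfl

/-- Commutators of lifts are exactly the $x \wedge y$, which generate the kernel. -/
theorem isStemExtension_proj {A : Type u} [CommGroup A]
    {β : Additive A →ₗ[ℤ] Additive A →ₗ[ℤ] ExtSquare (Additive A)}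
    (hβ : ∀ x y, β x y - β y x = wedge x y) : IsStemExtension (proj A β) where
  surjective a := ⟨⟨0, Additive.ofMul a⟩, rfl⟩
  ker_le_center g hg := by
    have hb : g.base = 0 := hg
    rw [Subgroup.mem_center_iff]
    intro h
    ext <;> simp [hb, add_comm]
  ker_le_commutator g hg := by
    have hb : g.base = 0 := hg
    suffices h : ∀ w : ExtSquare (Additive A),
        incl β (Multiplicative.ofAdd w) ∈ commutator (BilinExtension β) by
      have := h g.fiber
      rwa [show incl β (Multiplicative.ofAdd g.fiber) = g from
        BilinExtension.ext rfl hb.symm] at this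
    intro w
    obtain ⟨t, rfl⟩ := Submodule.Quotient.mk_surjective _ w
    induction t with
    | zero => exact one_mem _
    | tmul x y =>
      have hc := Subgroup.commutator_mem_commutator
        (Subgroup.mem_top (⟨0, x⟩ : BilinExtension β))
        (Subgroup.mem_top (⟨0, y⟩ : BilinExtension β))
      rw [commutatorElement_eq] at hc
      simp only [hβ] at hc
      exact hc
    | add x y hx hy =>
      rw [Submodule.Quotient.mk_add, ofAdd_add, map_mul]
      exact mul_mem hx hy

end BilinExtension

end BilinearExtension

/-! ### Stem extensions and Schur covers of abelian groups -/

section StemExtension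

variable {A E : Type u} [CommGroup A] [Group E] {π : E →* A}

theorem commutatorElement_mem_ker (a b : E) : ⁅a, b⁆ ∈ π.ker := by
  rw [MonoidHom.mem_ker, map_commutatorElement, commutatorElement_eq_one_iff_mul_comm, mul_comm]

namespace IsStemExtension

theorem commutatorElement_comm (hπ : IsStemExtension π) (a b c : E) :
    c * ⁅a, b⁆ = ⁅a, b⁆ * c :=
  Subgroup.mem_center_iff.1 (hπ.ker_le_center (commutatorElement_mem_ker a b)) c

theorem commutatorElement_mul_left (hπ : IsStemExtension π) (a b c : E) :
    ⁅a * b, c⁆ = ⁅a, c⁆ * ⁅b, c⁆ := by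
  have h := hπ.commutatorElement_comm b c a
  calc ⁅a * b, c⁆ = (a * ⁅b, c⁆) * (c * a⁻¹ * c⁻¹) := by simp only [commutatorElement_def]; group
    _ = ⁅b, c⁆ * ⁅a, c⁆ := by rw [h]; simp only [commutatorElement_def]; group
    _ = ⁅a, c⁆ * ⁅b, c⁆ := hπ.commutatorElement_comm _ _ _

theorem commutatorElement_mul_right (hπ : IsStemExtension π) (a b c : E) :
    ⁅a, b * c⁆ = ⁅a, b⁆ * ⁅a, c⁆ := by
  rw [← inv_inj, commutatorElement_inv, hπ.commutatorElement_mul_left, mul_inv_rev,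
    commutatorElement_inv, commutatorElement_inv, hπ.commutatorElement_comm]

/-- Two preimages of the same element differ by a central factor. -/
theorem commutatorElement_congr (hπ : IsStemExtension π) {a a' b b' : E} (ha : π a = π a')
    (hb : π b = π b') : ⁅a, b⁆ = ⁅a', b'⁆ := by
  have central {z : E} (hz : z ∈ π.ker) (c : E) : c * z = z * c :=
    Subgroup.mem_center_iff.1 (hπ.ker_le_center hz) c
  obtain ⟨z, hz, rfl⟩ : ∃ z ∈ π.ker, a' * z = a :=
    ⟨a'⁻¹ * a, by simp [MonoidHom.mem_ker, ha], by group⟩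
  obtain ⟨w, hw, rfl⟩ : ∃ w ∈ π.ker, b' * w = b :=
    ⟨b'⁻¹ * b, by simp [MonoidHom.mem_ker, hb], by group⟩
  rw [hπ.commutatorElement_mul_left, hπ.commutatorElement_mul_right,
    commutatorElement_eq_one_iff_mul_comm.2 (central hz (b' * w)).symm,
    commutatorElement_eq_one_iff_mul_comm.2 (central hw a'), mul_one, mul_one]

/-- The commutator map of a stem extension of an abelian group factors through the exterior
square, which maps onto the kernel. -/
theorem exists_extSquare_hom (hπ : IsStemExtension π) :
    ∃ φ : Multiplicative (ExtSquare (Additive A)) →* E,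
      (∀ a b, φ (Multiplicative.ofAdd (wedge (Additive.ofMul (π a)) (Additive.ofMul (π b)))) =
        ⁅a, b⁆) ∧ π.ker ≤ φ.range := by
  -- A set-theoretic section suffices, since commutators do not depend on the lifts.
  obtain ⟨s, hs⟩ := hπ.surjective.hasRightInverse
  let ω : Additive A →ₗ[ℤ] Additive A →ₗ[ℤ] Additive (Subgroup.center E) :=
    bilinOfAdd (fun x y => Additive.ofMul
        ⟨⁅s x.toMul, s y.toMul⁆, hπ.ker_le_center (commutatorElement_mem_ker _ _)⟩)
      (fun x x' y => by
        apply Additive.toMul.injective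
        apply Subtype.ext
        change ⁅s (x + x').toMul, s y.toMul⁆ = ⁅s x.toMul, s y.toMul⁆ * ⁅s x'.toMul, s y.toMul⁆
        rw [← hπ.commutatorElement_mul_left]
        exact hπ.commutatorElement_congr (by rw [map_mul, hs, hs, hs, toMul_add]) rfl)
      (fun x y y' => by
        apply Additive.toMul.injective
        apply Subtype.ext
        change ⁅s x.toMul, s (y + y').toMul⁆ = ⁅s x.toMul, s y.toMul⁆ * ⁅s x.toMul, s y'.toMul⁆
        rw [← hπ.commutatorElement_mul_right]
        exact hπ.commutatorElement_congr rfl (by rw [map_mul, hs, hs, hs, toMul_add]))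
  have hω (x : Additive A) : ω x x = 0 := by
    apply Additive.toMul.injective
    apply Subtype.ext
    exact commutatorElement_self _
  obtain ⟨f, hf⟩ := exists_extSquare_lift ω hω
  let φ : Multiplicative (ExtSquare (Additive A)) →* E :=
    (Subgroup.center E).subtype.comp (AddMonoidHom.toMultiplicativeLeft f.toAddMonoidHom)
  have hφ (a b : E) : φ (Multiplicative.ofAdd
      (wedge (Additive.ofMul (π a)) (Additive.ofMul (π b)))) = ⁅a, b⁆ := by
    change ((f (wedge (Additive.ofMul (π a)) (Additive.ofMul (π b)))).toMul : E) = _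
    rw [hf]
    exact hπ.commutatorElement_congr (hs _) (hs _)
  refine ⟨φ, hφ, hπ.ker_le_commutator.trans ?_⟩
  rw [commutator_def, Subgroup.commutator_le]
  exact fun a _ b _ => ⟨_, hφ a b⟩

theorem card_eq (hπ : IsStemExtension π) : Nat.card E = Nat.card A * Nat.card π.ker := by
  rw [Subgroup.card_eq_card_quotient_mul_card_subgroup π.ker,
    Nat.card_congr (QuotientGroup.quotientKerEquivOfSurjective π hπ.surjective).toEquiv]

variable [Finite A]

theorem card_le (hπ : IsStemExtension π) :
    Nat.card E ≤ Nat.card A * Nat.card (ExtSquare (Additive A)) := by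
  obtain ⟨φ, -, hφ⟩ := hπ.exists_extSquare_hom
  rw [hπ.card_eq]
  have : Finite φ.range := Finite.of_surjective _ φ.rangeRestrict_surjective
  refine Nat.mul_le_mul_left _ ?_
  calc Nat.card π.ker ≤ Nat.card φ.range :=
        Nat.card_le_card_of_injective _ (Subgroup.inclusion_injective hφ)
    _ ≤ Nat.card (Multiplicative (ExtSquare (Additive A))) :=
        Nat.card_le_card_of_surjective _ φ.rangeRestrict_surjective
    _ = Nat.card (ExtSquare (Additive A)) := rfl

end IsStemExtension

/-- A finite abelian group has a stem extension whose kernel is the exterior square. -/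
theorem exists_stemExtension_card (A : Type u) [CommGroup A] [Finite A] :
    ∃ (E : Type u) (_ : Group E) (_ : Finite E) (π : E →* A), IsStemExtension π ∧
      Nat.card E = Nat.card A * Nat.card (ExtSquare (Additive A)) := by
  obtain ⟨β, hβ⟩ := exists_bilin_sub_flip (wedge (B := Additive A)) wedge_self
  refine ⟨BilinExtension β, inferInstance, Finite.of_equiv _ (BilinExtension.equivProd β).symm,
    BilinExtension.proj A β, BilinExtension.isStemExtension_proj hβ, ?_⟩
  rw [Nat.card_congr (BilinExtension.equivProd β), Nat.card_prod, mul_comm]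
  rfl

theorem exists_isSchurCover (A : Type u) [CommGroup A] [Finite A] :
    ∃ (E : Type u) (_ : Group E) (π : E →* A), IsSchurCover π := by
  obtain ⟨E, _, hE, π, hπ, hcard⟩ := exists_stemExtension_card A
  exact ⟨E, _, π, hπ, hE, fun F _ _ ρ hρ => hcard ▸ hρ.card_le⟩

/-- In a Schur cover of a finite abelian group, two elements commute if and only if the exterior
product of their images vanishes. -/
theorem IsSchurCover.commute_iff [Finite A] (hπ : IsSchurCover π) (a b : E) :
    Commute a b ↔ wedge (Additive.ofMul (π a)) (Additive.ofMul (π b)) = 0 := by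
  obtain ⟨φ, hφ, hker⟩ := hπ.stem.exists_extSquare_hom
  have := hπ.finite
  obtain ⟨F, _, _, ρ, hρ, hF⟩ := exists_stemExtension_card A
  have hle := hπ.maximal F ρ hρ
  rw [hF, hπ.stem.card_eq] at hle
  have hcard : Nat.card (Multiplicative (ExtSquare (Additive A))) ≤ Nat.card φ.range :=
    (Nat.le_of_mul_le_mul_left hle Nat.card_pos).trans
      (Nat.card_le_card_of_injective _ (Subgroup.inclusion_injective hker))
  -- By maximality the image of `φ` is at least as large as its finite domain.
  have hinj : Function.Injective φ := by
    have hbij : Function.Bijective φ.rangeRestrict :=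
      (Nat.bijective_iff_surjective_and_card _).2 ⟨φ.rangeRestrict_surjective,
        hcard.antisymm (Nat.card_le_card_of_surjective _ φ.rangeRestrict_surjective)⟩
    exact MonoidHom.rangeRestrict_injective_iff.1 hbij.1
  rw [← commutatorElement_eq_one_iff_commute, ← hφ, map_eq_one_iff φ hinj, ofAdd_eq_one]

theorem IsSchurCover.deepCommutingGraph_adj_iff [Finite A] (hπ : IsSchurCover π) (x y : A) :
    (deepCommutingGraph π).Adj x y ↔
      x ≠ y ∧ wedge (Additive.ofMul x) (Additive.ofMul y) = 0 := by
  refine and_congr_right fun _ => ⟨fun h => ?_, ?_⟩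
  · obtain ⟨a, rfl⟩ := hπ.stem.surjective x
    obtain ⟨b, rfl⟩ := hπ.stem.surjective y
    exact (hπ.commute_iff a b).1 (h a b rfl rfl)
  · rintro h a b rfl rfl
    exact (hπ.commute_iff a b).2 h

end StemExtension


/-! ### Cyclicity criteria in abelian groups -/

section CyclicCriteria

variable {A : Type*} [CommGroup A]

/-- `g` sends `(f.comp g).ker` into `f.ker`, with fibres no larger than `g.ker`. -/
theorem card_ker_comp_le [Finite A] {B C : Type*} [Group B] [Group C] [Finite B]
    (f : B →* C) (g : A →* B) :
    Nat.card (f.comp g).ker ≤ Nat.card f.ker * Nat.card g.ker := by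
  let h : (f.comp g).ker →* B := g.comp (f.comp g).ker.subtype
  have hrange : h.range ≤ f.ker := by
    rintro _ ⟨x, rfl⟩
    exact x.2
  have hker : Nat.card h.ker ≤ Nat.card g.ker :=
    Nat.card_le_card_of_injective
      (fun x : h.ker => (⟨(x : (f.comp g).ker), x.2⟩ : g.ker))
      (fun x y hxy => Subtype.ext (Subtype.ext (congrArg (fun z : g.ker => (z : A)) hxy)))
  rw [← Subgroup.card_mul_index h.ker, Subgroup.index_ker, mul_comm]
  exact Nat.mul_le_mul
    (Nat.card_le_card_of_injective _ (Subgroup.inclusion_injective hrange)) hker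

/-- A finite abelian `p`-group with at most `p` elements of exponent `p` is cyclic. -/
theorem IsPGroup.isCyclic_of_card_ker_pow_le [Finite A] {p : ℕ} (hp : p.Prime)
    (hA : IsPGroup p A) (h : Nat.card (powMonoidHom (α := A) p).ker ≤ p) : IsCyclic A := by
  have := Fact.mk hp
  have hbound (k : ℕ) : Nat.card (powMonoidHom (α := A) (p ^ k)).ker ≤ p ^ k := by
    induction k with
    | zero =>
      simp
    | succ k ih =>
      have hcomp : powMonoidHom (α := A) (p ^ (k + 1)) =
          (powMonoidHom (α := A) p).comp (powMonoidHom (p ^ k)) := by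
        ext x
        simp [pow_succ, pow_mul]
      rw [hcomp, pow_succ']
      exact (card_ker_comp_le _ _).trans (Nat.mul_le_mul h ih)
  obtain ⟨m, hm⟩ := hA.exists_card_eq
  obtain ⟨n, -, hn⟩ := (Nat.dvd_prime_pow hp).1 (hm ▸ Group.exponent_dvd_nat_card (G := A))
  obtain ⟨g, hg⟩ := Monoid.exists_orderOf_eq_exponent (Monoid.ExponentExists.of_finite (G := A))
  have htop : (powMonoidHom (α := A) (p ^ n)).ker = ⊤ := by
    ext x
    simp [MonoidHom.mem_ker, ← hn, Monoid.pow_exponent_eq_one]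
  -- The exponent $p^n$ is the order of `g`, and `hbound n` gives $|A| \le p^n$.
  refine isCyclic_iff_exists_natCard_le_orderOf.2 ⟨g, ?_⟩
  have := hbound n
  rwa [htop, Subgroup.card_top, ← hn, ← hg] at this

/-- A generator would have order dividing $p$, so it would generate no more than $\langle u\rangle$.
-/
theorem not_isCyclic_closure_pair {p : ℕ} (hp : p.Prime) {u v : A} (hu : u ^ p = 1)
    (hv : v ^ p = 1) (hu1 : u ≠ 1) (huv : v ∉ Subgroup.zpowers u) :
    ¬ IsCyclic (Subgroup.closure ({u, v} : Set A)) := by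
  intro hc
  have := Fact.mk hp
  obtain ⟨g, hg⟩ := (Subgroup.isCyclic_iff_exists_zpowers_eq_top _).1 hc
  have hle : Subgroup.closure ({u, v} : Set A) ≤ (powMonoidHom (α := A) p).ker := by
    rw [Subgroup.closure_le]
    rintro x (rfl | rfl)
    · exact hu
    · exact hv
  have hgp : g ^ p = 1 := hle (hg ▸ Subgroup.mem_zpowers g)
  have hug : u ∈ Subgroup.zpowers g := hg ▸ Subgroup.subset_closure (by simp)
  have hvg : v ∈ Subgroup.zpowers g := hg ▸ Subgroup.subset_closure (by simp)
  have hcard : Nat.card (Subgroup.zpowers g) ≤ Nat.card (Subgroup.zpowers u) := by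
    rw [Nat.card_zpowers, Nat.card_zpowers, orderOf_eq_prime hu hu1]
    exact Nat.le_of_dvd hp.pos (orderOf_dvd_of_pow_eq_one hgp)
  have : Finite (Subgroup.zpowers g) :=
    finite_zpowers.2 (isOfFinOrder_iff_pow_eq_one.2 ⟨p, hp.pos, hgp⟩)
  have heq := Subgroup.eq_of_le_of_card_ge (Subgroup.zpowers_le.2 hug) hcard
  exact huv (heq ▸ hvg)

/-- A two-generated subgroup is cyclic as soon as its projections to the Sylow subgroups are. -/
theorem isCyclic_closure_pair_of_sylow [Finite A] {x y : A}
    (h : ∀ p : ℕ, p.Prime → ∀ P : Sylow p A, ∃ w : A,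
      x ^ P.index ∈ Subgroup.zpowers w ∧ y ^ P.index ∈ Subgroup.zpowers w) :
    IsCyclic (Subgroup.closure ({x, y} : Set A)) := by
  set H := Subgroup.closure ({x, y} : Set A) with hH
  -- An abelian group with cyclic Sylow subgroups is cyclic.
  suffices IsZGroup H from inferInstance
  refine ⟨fun p hp Q => ?_⟩
  have := Fact.mk hp
  let P : Sylow p A := default
  obtain ⟨w, hx, hy⟩ := h p hp P
  have hle : H ≤ (Subgroup.zpowers w).comap (powMonoidHom P.index) := by
    rw [hH, Subgroup.closure_le]
    rintro z (rfl | rfl)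
    · exact hx
    · exact hy
  -- The index of `P` is prime to $p$, so this power map is injective on the $p$-group `Q`.
  let f : Q →* Subgroup.zpowers w :=
    ((powMonoidHom (α := A) P.index).comp (H.subtype.comp (Q : Subgroup H).subtype)).codRestrict
      _ (fun q => hle q.1.2)
  refine isCyclic_of_injective f ((injective_iff_map_eq_one f).2 fun q hq => ?_)
  have hqm : q ^ P.index = 1 := by
    apply Subtype.ext
    apply Subtype.ext
    exact congrArg (fun z : Subgroup.zpowers w => (z : A)) hq
  obtain ⟨k, hk⟩ := Q.isPGroup' q
  have hcop : Nat.Coprime P.index (p ^ k) :=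
    (Nat.Coprime.pow_left k ((Nat.Prime.coprime_iff_not_dvd hp).2 P.not_dvd_index)).symm
  exact orderOf_eq_one_iff.1 (Nat.eq_one_of_dvd_coprimes hcop
    (orderOf_dvd_of_pow_eq_one hqm) (orderOf_dvd_of_pow_eq_one hk))

end CyclicCriteria

/-! ### Vanishing of the wedge versus cyclicity -/

section Wedge

variable {A : Type*} [CommGroup A]

theorem wedge_eq_zero_of_isCyclic {x y : A}
    (h : IsCyclic (Subgroup.closure ({x, y} : Set A))) :
    wedge (Additive.ofMul x) (Additive.ofMul y) = 0 := by
  obtain ⟨g, hg⟩ := (Subgroup.isCyclic_iff_exists_zpowers_eq_top _).1 h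
  obtain ⟨m, rfl⟩ : x ∈ Subgroup.zpowers g := hg ▸ Subgroup.subset_closure (by simp)
  obtain ⟨n, rfl⟩ : y ∈ Subgroup.zpowers g := hg ▸ Subgroup.subset_closure (by simp)
  exact alternating_zsmul wedge_self (Additive.ofMul g) m n

/-- An abelian `p`-subgroup that is neither cyclic nor elementary abelian contains two elements
with trivial exterior product that do not generate a cyclic group. -/
theorem exists_wedge_eq_zero_not_isCyclic [Finite A] {p : ℕ} (hp : p.Prime) {P : Subgroup A}
    (hP : IsPGroup p P) (hc : ¬ IsCyclic P) (he : ¬ IsElementaryAbelian p P) :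
    ∃ u v : A, wedge (Additive.ofMul u) (Additive.ofMul v) = 0 ∧
      ¬ IsCyclic (Subgroup.closure ({u, v} : Set A)) := by
  have := Fact.mk hp
  obtain ⟨z, hz⟩ : ∃ z : P, z ^ p ≠ 1 := by
    by_contra! hall
    exact he ⟨mul_comm, hall⟩
  -- Repeated $p$-th powers of `z` reach an element of order exactly $p^2$.
  obtain ⟨w, hw, hw1⟩ : ∃ w : P, (w ^ p) ^ p = 1 ∧ w ^ p ≠ 1 := by
    obtain ⟨k, hk⟩ := hP z
    induction k generalizing z with
    | zero => exact absurd (by simpa using hk) (fun h : z = 1 => hz (by rw [h, one_pow]))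
    | succ k ih =>
      by_cases h : (z ^ p) ^ p = 1
      · exact ⟨z, h, hz⟩
      · exact ih (z ^ p) h (by rw [← pow_mul, ← pow_succ', hk])
  obtain ⟨v, hv, hvu⟩ : ∃ v : P, v ^ p = 1 ∧ v ∉ Subgroup.zpowers (w ^ p) := by
    by_contra! hall
    refine hc (hP.isCyclic_of_card_ker_pow_le hp ?_)
    have hle : (powMonoidHom (α := P) p).ker ≤ Subgroup.zpowers (w ^ p) := hall
    refine (Nat.card_le_card_of_injective _ (Subgroup.inclusion_injective hle)).trans ?_
    rw [Nat.card_zpowers, orderOf_eq_prime hw hw1]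
  refine ⟨((w ^ p : P) : A), v, ?_, not_isCyclic_closure_pair hp ?_ ?_ ?_ fun hmem => hvu ?_⟩
  · have hv' : p • Additive.ofMul (v : A) = 0 := by
      rw [← ofMul_pow, ← Subgroup.coe_pow, hv]
      rfl
    -- Bilinearity moves the factor $p$ across: $w^p \wedge v = w \wedge v^p$.
    rw [Subgroup.coe_pow, ofMul_pow, map_nsmul, LinearMap.smul_apply, ← map_nsmul, hv', map_zero]
  · exact_mod_cast hw
  · exact_mod_cast hv
  · exact_mod_cast hw1
  · obtain ⟨n, hn⟩ := hmem
    exact ⟨n, Subtype.ext hn⟩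

/-- Elements of an elementary abelian `p`-group with trivial exterior product, detected along a
homomorphism, lie in a common cyclic subgroup. -/
theorem exists_mem_zpowers_of_wedge_eq_zero {V : Type*} [CommGroup V] {p : ℕ} (hp : p.Prime)
    (hV : ∀ v : V, v ^ p = 1) (r : A →* V) {x y : A}
    (h : wedge (Additive.ofMul x) (Additive.ofMul y) = 0) :
    ∃ w : V, r x ∈ Subgroup.zpowers w ∧ r y ∈ Subgroup.zpowers w := by
  have := Fact.mk hp
  let _ : Module (ZMod p) (Additive V) := AddCommGroup.zmodModule (n := p) hV
  let s : Additive A →+ Additive V := MonoidHom.toAdditive r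
  by_cases hx : s (Additive.ofMul x) = 0
  · exact ⟨r y, (show r x = 1 from hx) ▸ one_mem _, Subgroup.mem_zpowers _⟩
  by_cases hy : s (Additive.ofMul y) ∈ Submodule.span (ZMod p) {s (Additive.ofMul x)}
  · obtain ⟨c, hc⟩ := Submodule.mem_span_singleton.1 hy
    refine ⟨r x, Subgroup.mem_zpowers _, (c.cast : ℤ), ?_⟩
    rw [← ZMod.intCast_zmod_cast c, Int.cast_smul_eq_zsmul] at hc
    exact hc
  exfalso
  obtain ⟨f, hfy, hf⟩ := Submodule.exists_dual_map_eq_bot_of_notMem hy inferInstance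
  obtain ⟨g, hgx⟩ := Module.Projective.exists_dual_ne_zero (ZMod p) hx
  have hfx : f (s (Additive.ofMul x)) = 0 := by
    have : f (s (Additive.ofMul x)) ∈ (Submodule.span (ZMod p) {s (Additive.ofMul x)}).map f :=
      Submodule.mem_map_of_mem (Submodule.mem_span_singleton_self _)
    rwa [hf, Submodule.mem_bot] at this
  -- The form $f \wedge g$ pulled back along `r` takes the value $-g(x)f(y) \ne 0$ at $(x, y)$,
  -- although $x \wedge y = 0$.
  obtain ⟨F, hF⟩ := exists_extSquare_lift
    (bilinOfAdd (fun a b : Additive A => f (s a) * g (s b) - g (s a) * f (s b))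
      (fun a a' b => by simp only [map_add]; ring)
      (fun a b b' => by simp only [map_add]; ring))
    (fun a => by rw [bilinOfAdd_apply]; ring)
  have h0 := hF (Additive.ofMul x) (Additive.ofMul y)
  rw [h, map_zero, bilinOfAdd_apply, hfx, zero_mul, zero_sub, eq_comm, neg_eq_zero] at h0
  exact mul_ne_zero hgx hfy h0

theorem isCyclic_closure_pair_of_wedge_eq_zero [Finite A]
    (hA : ∀ p : ℕ, p.Prime → ∀ P : Sylow p A, IsCyclic P ∨ IsElementaryAbelian p P) {x y : A}
    (h : wedge (Additive.ofMul x) (Additive.ofMul y) = 0) :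
    IsCyclic (Subgroup.closure ({x, y} : Set A)) := by
  refine isCyclic_closure_pair_of_sylow fun p hp P => ?_
  let r : A →* P := (powMonoidHom (α := A) P.index).codRestrict _
    fun a => Subgroup.pow_index_mem _ a
  obtain ⟨w, hx, hy⟩ : ∃ w : P, r x ∈ Subgroup.zpowers w ∧ r y ∈ Subgroup.zpowers w := by
    rcases hA p hp P with hc | he
    · obtain ⟨w, hw⟩ := IsCyclic.exists_generator (α := P)
      exact ⟨w, hw _, hw _⟩
    · exact exists_mem_zpowers_of_wedge_eq_zero hp he.2 r h
  have hmap {a : P} (ha : a ∈ Subgroup.zpowers w) : (a : A) ∈ Subgroup.zpowers (w : A) := by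
    obtain ⟨n, rfl⟩ := ha
    exact ⟨n, rfl⟩
  exact ⟨w, hmap hx, hmap hy⟩

end Wedge

/-! ### Comparison of the two graphs -/

section DeepCommutingGraph

variable {A E : Type u} [CommGroup A] [Finite A] [Group E] {π : E →* A}

theorem IsSchurCover.deepCommutingGraph_eq_iff_wedge (hπ : IsSchurCover π) :
    deepCommutingGraph π = enhancedPowerGraph A ↔
      ∀ x y : A, wedge (Additive.ofMul x) (Additive.ofMul y) = 0 →
        IsCyclic (Subgroup.closure ({x, y} : Set A)) := by
  constructor
  · intro h x y hxy
    by_cases hne : x = y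
    · subst hne
      rw [Set.pair_eq_singleton, ← Subgroup.zpowers_eq_closure]
      infer_instance
    · have hadj := (hπ.deepCommutingGraph_adj_iff x y).2 ⟨hne, hxy⟩
      rw [h] at hadj
      exact hadj.2
  · intro h
    ext x y
    rw [hπ.deepCommutingGraph_adj_iff]
    exact and_congr_right fun _ => ⟨h x y, wedge_eq_zero_of_isCyclic⟩

theorem IsSchurCover.deepCommutingGraph_eq_iff_sylow (hπ : IsSchurCover π) :
    deepCommutingGraph π = enhancedPowerGraph A ↔
      ∀ p : ℕ, p.Prime → ∀ P : Sylow p A, IsCyclic P ∨ IsElementaryAbelian p P := by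
  rw [hπ.deepCommutingGraph_eq_iff_wedge]
  refine ⟨fun h p hp P => ?_, fun h x y hxy => isCyclic_closure_pair_of_wedge_eq_zero h hxy⟩
  by_contra! hP
  obtain ⟨u, v, huv, hc⟩ := exists_wedge_eq_zero_not_isCyclic hp P.isPGroup' hP.1 hP.2
  exact hc (h u v huv)

theorem forall_sylow_iff_isElementaryAbelian {p : ℕ} (hp : p.Prime) (hA : IsPGroup p A)
    (hc : ¬ IsCyclic A) :
    (∀ q : ℕ, q.Prime → ∀ P : Sylow q A, IsCyclic P ∨ IsElementaryAbelian q P) ↔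
      IsElementaryAbelian p A := by
  have := Fact.mk hp
  constructor
  · intro h
    let P : Sylow p A := default
    have hP : (P : Subgroup A) = ⊤ := (P.is_maximal' (Q := ⊤) (hA.to_subgroup ⊤) le_top).symm
    have hmem (x : A) : x ∈ (P : Subgroup A) := hP ▸ Subgroup.mem_top x
    rcases h p hp P with hcyc | he
    · refine absurd (isCyclic_of_surjective (P : Subgroup A).subtype fun x => ?_) hc
      exact ⟨⟨x, hmem x⟩, rfl⟩
    · exact ⟨mul_comm, fun x => congrArg Subtype.val (he.2 ⟨x, hmem x⟩)⟩
  · intro h q hq P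
    have := Fact.mk hq
    by_cases hqp : q = p
    · subst hqp
      exact Or.inr ⟨mul_comm, fun x => Subtype.ext (h.2 x)⟩
    · left
      have : Subsingleton P := by
        refine ⟨fun a b => ?_⟩
        have key (c : P) : c = 1 := by
          obtain ⟨k, hk⟩ := P.isPGroup' c
          have hcp : c ^ p = 1 := Subtype.ext (h.2 c)
          exact orderOf_eq_one_iff.1 (Nat.eq_one_of_dvd_coprimes
            (Nat.Coprime.pow_left k ((Nat.coprime_primes hq hp).2 hqp))
            (orderOf_dvd_of_pow_eq_one hk) (orderOf_dvd_of_pow_eq_one hcp))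
        rw [key a, key b]
      infer_instance

end DeepCommutingGraph

theorem mainTheorem6 (A : Type u) [CommGroup A] [Finite A] :
    (∃ (E : Type u) (_ : Group E) (π : E →* A), IsSchurCover π) ∧
    ∀ (E : Type u) [Group E] (π : E →* A), IsSchurCover π →
      (∀ p : ℕ, p.Prime → IsPGroup p A → ¬ IsCyclic A →
        (deepCommutingGraph π = enhancedPowerGraph A ↔ IsElementaryAbelian p A)) ∧
      (deepCommutingGraph π = enhancedPowerGraph A ↔
        ∀ p : ℕ, p.Prime → ∀ P : Sylow p A, IsCyclic P ∨ IsElementaryAbelian p P) :=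
  ⟨exists_isSchurCover A, fun _ _ _ hπ =>
    ⟨fun _ hp hA hc => hπ.deepCommutingGraph_eq_iff_sylow.trans
      (forall_sylow_iff_isElementaryAbelian hp hA hc), hπ.deepCommutingGraph_eq_iff_sylow⟩⟩
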